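/- Let $\Gamma$ be a countable discrete group. For an algebraic ideal $D$ of $\ell^\infty(\Gamma)$, a unitary representation $\pi$ of $\Gamma$ on a Hilbert space $\mathcal H$ is called a $D$-representation if there is a dense linear subspace $\mathcal H_0\subset\mathcal H$ such that the function $s\mapsto\langle\pi_s\xi,\eta\rangle$ belongs to $D$ for all $\xi,\eta\in\mathcal H_0$. Let $C^*_D(\Gamma)$ be the C*-algebra obtained from the group ring $\mathbb C[\Gamma]$ by (separation and) completion with respect to $\|x\|_D=\sup\{\|\pi(x)\| : \pi \text{ is a } D\text{-representation}\}$, and let $C^*(\Gamma)$ be the full group C*-algebra, that is, the completion of $\mathbb C[\Gamma]$ with respect to the supremum of $\|\pi(x)\|$ over all unitary representations $\pi$ of $\Gamma$. Write $C^*(\Gamma)=C^*_D(\Gamma)$ if the canonical map $C^*(\Gamma)\to C^*_D(\Gamma)$ extending the identity of $\mathbb C[\Gamma]$ is an isomorphism. **Proposition.** If there exists $p\in[1,\infty)$ for which $C^*(\Gamma)=C^*_{\ell^p(\Gamma)}(\Gamma)$, then $\Gamma$ is amenable, that is, there exist finitely supported functions $h_n\colon\Gamma\to\mathbb C$ ($n\in\mathbb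 N$) that are positive definite (for all $s_1,\dots,s_m\in\Gamma$ the matrix $[h_n(s_is_j^{-1})]_{i,j}$ is positive semidefinite) and converge pointwise to the constant function $1$. -/

import Mathlib

open scoped ENNReal ComplexConjugate ComplexOrder

universe u

noncomputable section

/-! ### The involution on the completion of a seminormed *-ring -/

namespace UniformSpace.Completion

variable {A : Type*} [SeminormedRing A] [StarRing A]

/-- The involution of the completion: the continuous extension of the involution of `A`. -/
instance instStarOfNormed : Star (Completion A) where
  star := Completion.map star

theorem continuous_star_of_normed : Continuous (star : Completion A → Completion A) :=
  Completion.continuous_map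

variable [NormedStarGroup A]

theorem uniformContinuous_star_of_normed : UniformContinuous (star : A → A) :=
  AddMonoidHomClass.uniformContinuous_of_bound (starAddEquiv : A ≃+ A) 1 fun x => by simp

theorem coe_star (a : A) : ((star a : A) : Completion A) = star (a : Completion A) :=
  (Completion.map_coe uniformContinuous_star_of_normed a).symm

instance instStarRingOfNormed : StarRing (Completion A) where
  star_involutive x := by
    induction x using Completion.induction_on with
    | hp => exact isClosed_eq (continuous_star_of_normed.comp continuous_star_of_normed)
              continuous_id
    | ih a => rw [← coe_star, ← coe_star, star_star]
  star_mul x y := by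
    induction x, y using Completion.induction_on₂ with
    | hp =>
      exact isClosed_eq (continuous_star_of_normed.comp (by fun_prop))
        ((continuous_star_of_normed.comp continuous_snd).mul
          (continuous_star_of_normed.comp continuous_fst))
    | ih a b => rw [← coe_mul, ← coe_star, ← coe_star, ← coe_star, ← coe_mul, star_mul]
  star_add x y := by
    induction x, y using Completion.induction_on₂ with
    | hp =>
      exact isClosed_eq (continuous_star_of_normed.comp (by fun_prop))
        ((continuous_star_of_normed.comp continuous_fst).add
          (continuous_star_of_normed.comp continuous_snd))
    | ih a b => rw [← coe_add, ← coe_star, ← coe_star, ← coe_star, ← coe_add, star_add]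

end UniformSpace.Completion

/-! ### Unitary representations -/

/-- A unitary representation of a discrete group `Γ` on a complex Hilbert space. -/
structure UnitaryRep (Γ : Type u) [Group Γ] where
  H : Type u
  [instNormed : NormedAddCommGroup H]
  [instInner : InnerProductSpace ℂ H]
  [instComplete : CompleteSpace H]
  hom : Γ →* unitary (H →L[ℂ] H)

attribute [instance] UnitaryRep.instNormed UnitaryRep.instInner UnitaryRep.instComplete

namespace UnitaryRep

variable {Γ : Type u} [Group Γ]

/-- The operator `π_s`. -/
def op (π : UnitaryRep Γ) (s : Γ) : π.H →L[ℂ] π.H := (π.hom s : π.H →L[ℂ] π.H)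

theorem norm_op_apply (π : UnitaryRep Γ) (s : Γ) (v : π.H) : ‖π.op s v‖ = ‖v‖ :=
  Unitary.norm_map (π.hom s) v

/-- The extension of `π` to the group ring, `∑ a_s s ↦ ∑ a_s π_s`. -/
def extend (π : UnitaryRep Γ) : MonoidAlgebra ℂ Γ →ₐ[ℂ] (π.H →L[ℂ] π.H) :=
  MonoidAlgebra.lift ℂ (π.H →L[ℂ] π.H) Γ
    ((unitary (π.H →L[ℂ] π.H)).subtype.comp π.hom)

/-- The matrix coefficient function `s ↦ ⟨π_s ξ, η⟩` (with an inner product that is linear in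
the first variable; Mathlib's is linear in the second), an element of `ℓ^∞(Γ)`. -/
def matrixCoeff (π : UnitaryRep Γ) (ξ η : π.H) : lp (fun _ : Γ => ℂ) ∞ :=
  ⟨fun s => inner ℂ η (π.op s ξ), memℓp_infty ⟨‖η‖ * ‖ξ‖, by
    rintro _ ⟨s, rfl⟩
    exact (norm_inner_le_norm _ _).trans_eq (by rw [norm_op_apply])⟩⟩

/-- `π` is a `D`-representation: the matrix coefficients coming from some dense linear subspace
belong to the ideal `D` of `ℓ^∞(Γ)`. -/
def IsDRep (D : Ideal (lp (fun _ : Γ => ℂ) ∞)) (π : UnitaryRep Γ) : Prop :=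
  ∃ H₀ : Submodule ℂ π.H, Dense (H₀ : Set π.H) ∧ ∀ ξ ∈ H₀, ∀ η ∈ H₀, π.matrixCoeff ξ η ∈ D

end UnitaryRep

/-- The (algebraic) ideal `ℓ^p(Γ)` of `ℓ^∞(Γ)`. -/
def ellpIdeal (Γ : Type u) (p : ℝ≥0∞) : Ideal (lp (fun _ : Γ => ℂ) ∞) where
  carrier := {f | Memℓp (f : Γ → ℂ) p}
  add_mem' hf hg := by
    exact Memℓp.add hf hg
  zero_mem' := zero_memℓp
  smul_mem' c f hf := by
    have hle : ∀ i, ‖(c * f) i‖ ≤ ‖c‖ * ‖f i‖ := fun i => by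
      rw [lp.infty_coeFn_mul, Pi.mul_apply, norm_mul]
      exact mul_le_mul_of_nonneg_right (lp.norm_apply_le_norm (by simp) c i) (norm_nonneg _)
    change Memℓp (fun i => (c * f) i) p
    rcases p.trichotomy with rfl | rfl | hp
    · refine memℓp_zero (hf.finite_dsupport.subset fun i hi hfi => hi ?_)
      have h := hle i
      rw [hfi, norm_zero, mul_zero] at h
      exact norm_le_zero_iff.1 h
    · exact lp.memℓp (c * f)
    · refine memℓp_gen (.of_nonneg_of_le (fun i => by positivity) (fun i => ?_)
        ((hf.summable hp).mul_left (‖c‖ ^ p.toReal)))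
      rw [← Real.mul_rpow (norm_nonneg _) (norm_nonneg _)]
      exact Real.rpow_le_rpow (norm_nonneg _) (hle i) hp.le

/-! ### Group C*-algebras -/

/-- The group ring `ℂ[Γ]`, to be endowed with the C*-seminorm given by the unitary
representations in the class `P`. -/
def GroupRing {Γ : Type u} [Group Γ] (_P : UnitaryRep Γ → Prop) : Type u := MonoidAlgebra ℂ Γ

namespace GroupRing

variable {Γ : Type u} [Group Γ] (P : UnitaryRep Γ → Prop)

instance instRing : Ring (GroupRing P) := inferInstanceAs (Ring (MonoidAlgebra ℂ Γ))

instance instAlgebra : Algebra ℂ (GroupRing P) := inferInstanceAs (Algebra ℂ (MonoidAlgebra ℂ Γ))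

/-- The group element `s` in the group ring. -/
def of (s : Γ) : GroupRing P := MonoidAlgebra.of ℂ Γ s

variable {P}

/-- Every element of the group ring is a finite linear combination of group elements. -/
theorem induction {p : GroupRing P → Prop} (x : GroupRing P) (hof : ∀ s, p (of P s))
    (hadd : ∀ x y, p x → p y → p (x + y)) (hsmul : ∀ (c : ℂ) x, p x → p (c • x)) : p x :=
  MonoidAlgebra.induction_on (motive := p) x hof hadd hsmul

theorem of_mul (s t : Γ) : of P (s * t) = of P s * of P t := map_mul (MonoidAlgebra.of ℂ Γ) s t

theorem of_one : of P 1 = 1 := map_one (MonoidAlgebra.of ℂ Γ)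

/-- The involution `∑ a_s s ↦ ∑ conj(a_s) s⁻¹` of the group ring. -/
def starHom : GroupRing P →+ GroupRing P where
  toFun x := (MonoidAlgebra.coeff x).sum fun s a => conj a • of P s⁻¹
  map_zero' := Finsupp.sum_zero_index
  map_add' x y := Finsupp.sum_add_index' (by simp) (by simp [add_smul])

theorem starHom_of (s : Γ) : starHom (of P s) = of P s⁻¹ := by
  change (Finsupp.single s (1 : ℂ)).sum (fun s a => conj a • of P s⁻¹) = _
  rw [Finsupp.sum_single_index] <;> simp

theorem starHom_smul (c : ℂ) (x : GroupRing P) : starHom (c • x) = conj c • starHom x := by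
  change (c • MonoidAlgebra.coeff x).sum (fun s a => conj a • of P s⁻¹) =
    conj c • (MonoidAlgebra.coeff x).sum (fun s a => conj a • of P s⁻¹)
  rw [Finsupp.sum_smul_index (by simp), Finsupp.smul_sum]
  simp [mul_smul]

instance instStarRing : StarRing (GroupRing P) where
  star := starHom
  star_involutive x := by
    induction x using induction with
    | hof s => simp [starHom_of]
    | hadd x y hx hy => simp [hx, hy]
    | hsmul c x hx => simp [starHom_smul, hx]
  star_add := map_add starHom
  star_mul x y := by
    change starHom (x * y) = starHom y * starHom x
    induction x using induction with
    | hadd x x' hx hx' => simp [add_mul, mul_add, hx, hx']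
    | hsmul c x hx => simp [starHom_smul, hx]
    | hof s =>
      induction y using induction with
      | hadd x x' hx hx' => simp [add_mul, mul_add, hx, hx']
      | hsmul c x hx => simp [starHom_smul, hx]
      | hof t => simp [starHom_of, ← of_mul]

instance instStarModule : StarModule ℂ (GroupRing P) := ⟨starHom_smul⟩

theorem star_of (s : Γ) : star (of P s) = of P s⁻¹ := starHom_of s

/-- The extension of a representation to the group ring. -/
def rep (π : UnitaryRep Γ) : GroupRing P →ₐ[ℂ] (π.H →L[ℂ] π.H) := π.extend

theorem rep_of (π : UnitaryRep Γ) (s : Γ) : rep π (of P s) = π.op s :=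
  MonoidAlgebra.lift_of _ s

theorem rep_star (π : UnitaryRep Γ) (x : GroupRing P) : rep π (star x) = star (rep π x) := by
  induction x using induction with
  | hadd x y hx hy => simp [hx, hy]
  | hsmul c x hx => simp [star_smul, hx]
  | hof s =>
    rw [star_of, rep_of, rep_of, UnitaryRep.op, UnitaryRep.op, map_inv, ← Unitary.star_eq_inv,
      Unitary.coe_star]

theorem bddAbove (x : GroupRing P) :
    BddAbove (Set.range fun π : {π : UnitaryRep Γ // P π} => ‖rep π.1 x‖) := by
  induction x using induction with
  | hof s =>
    refine ⟨1, ?_⟩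
    rintro _ ⟨π, rfl⟩
    simp only [rep_of]
    exact ContinuousLinearMap.opNorm_le_bound _ zero_le_one fun v => by
      rw [UnitaryRep.norm_op_apply, one_mul]
  | hadd x y hx hy =>
    obtain ⟨a, ha⟩ := hx
    obtain ⟨b, hb⟩ := hy
    refine ⟨a + b, ?_⟩
    rintro _ ⟨π, rfl⟩
    simp only [map_add]
    exact (norm_add_le _ _).trans (add_le_add (ha ⟨π, rfl⟩) (hb ⟨π, rfl⟩))
  | hsmul c x hx =>
    obtain ⟨a, ha⟩ := hx
    refine ⟨‖c‖ * a, ?_⟩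
    rintro _ ⟨π, rfl⟩
    simp only [map_smul, norm_smul]
    exact mul_le_mul_of_nonneg_left (ha ⟨π, rfl⟩) (norm_nonneg c)

/-- The seminorm `‖x‖ = sup {‖π(x)‖ : π is a unitary representation in the class P}`. -/
instance instNorm : Norm (GroupRing P) where
  norm x := ⨆ π : {π : UnitaryRep Γ // P π}, ‖rep π.1 x‖

theorem norm_def (x : GroupRing P) : ‖x‖ = ⨆ π : {π : UnitaryRep Γ // P π}, ‖rep π.1 x‖ := rfl

theorem norm_nonneg' (x : GroupRing P) : 0 ≤ ‖x‖ := Real.iSup_nonneg fun _ => norm_nonneg _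

theorem norm_rep_le (x : GroupRing P) (π : UnitaryRep Γ) (hπ : P π) : ‖rep π x‖ ≤ ‖x‖ :=
  le_ciSup (bddAbove x) ⟨π, hπ⟩

theorem norm_le {x : GroupRing P} {c : ℝ} (hc : 0 ≤ c)
    (h : ∀ π : UnitaryRep Γ, P π → ‖rep π x‖ ≤ c) : ‖x‖ ≤ c :=
  Real.iSup_le (fun π => h π.1 π.2) hc

/-- The seminorm as an additive group seminorm. -/
def addSeminorm : AddGroupSeminorm (GroupRing P) where
  toFun := norm
  map_zero' := by simp [norm_def]
  add_le' x y := norm_le (add_nonneg (norm_nonneg' x) (norm_nonneg' y)) fun π hπ => by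
    rw [map_add]
    exact (norm_add_le _ _).trans (add_le_add (norm_rep_le x π hπ) (norm_rep_le y π hπ))
  neg' x := by simp [norm_def]

instance instSeminormedRing : SeminormedRing (GroupRing P) where
  toNorm := instNorm
  __ := addSeminorm.toSeminormedAddCommGroup
  __ := instRing P
  norm_mul_le x y := norm_le (mul_nonneg (norm_nonneg' x) (norm_nonneg' y)) fun π hπ => by
    rw [map_mul]
    exact (norm_mul_le _ _).trans
      (mul_le_mul (norm_rep_le x π hπ) (norm_rep_le y π hπ) (norm_nonneg _) (norm_nonneg' x))

instance instNormedAlgebra : NormedAlgebra ℂ (GroupRing P) where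
  __ := instAlgebra P
  norm_smul_le c x := norm_le (mul_nonneg (norm_nonneg c) (norm_nonneg' x)) fun π hπ => by
    rw [map_smul, norm_smul]
    exact mul_le_mul_of_nonneg_left (norm_rep_le x π hπ) (norm_nonneg c)

instance instNormedStarGroup : NormedStarGroup (GroupRing P) where
  norm_star_le x := norm_le (norm_nonneg' x) fun π hπ => by
    rw [rep_star, norm_star]
    exact norm_rep_le x π hπ

theorem norm_mul_self_le (x : GroupRing P) : ‖x‖ * ‖x‖ ≤ ‖star x * x‖ := by
  have h : ‖x‖ ≤ √‖star x * x‖ := norm_le (Real.sqrt_nonneg _) fun π hπ => by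
    refine Real.le_sqrt_of_sq_le ?_
    rw [sq, ← CStarRing.norm_star_mul_self, ← rep_star, ← map_mul]
    exact norm_rep_le _ π hπ
  calc ‖x‖ * ‖x‖ ≤ √‖star x * x‖ * √‖star x * x‖ :=
        mul_self_le_mul_self (norm_nonneg' x) h
    _ = ‖star x * x‖ := Real.mul_self_sqrt (norm_nonneg' _)

end GroupRing

/-- The C*-algebra obtained from `ℂ[Γ]` by (separation and) completion with respect to the
C*-seminorm `x ↦ sup {‖π(x)‖ : P π}`. -/
abbrev CStarCompletion {Γ : Type u} [Group Γ] (P : UnitaryRep Γ → Prop) : Type u :=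
  UniformSpace.Completion (GroupRing P)

instance CStarCompletion.instCStarAlgebra {Γ : Type u} [Group Γ] (P : UnitaryRep Γ → Prop) :
    CStarAlgebra (CStarCompletion P) where
  norm_mul_self_le x := by
    induction x using UniformSpace.Completion.induction_on with
    | hp =>
      exact isClosed_le (by fun_prop)
        ((UniformSpace.Completion.continuous_star_of_normed.mul continuous_id).norm)
    | ih a =>
      rw [← UniformSpace.Completion.coe_star, ← UniformSpace.Completion.coe_mul,
        UniformSpace.Completion.norm_coe, UniformSpace.Completion.norm_coe]
      exact GroupRing.norm_mul_self_le a
  norm_smul_le := norm_smul_le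
  star_smul c x := by
    induction x using UniformSpace.Completion.induction_on with
    | hp =>
      exact isClosed_eq
        (UniformSpace.Completion.continuous_star_of_normed.comp (continuous_const_smul c))
        (UniformSpace.Completion.continuous_star_of_normed.const_smul (star c))
    | ih a =>
      rw [← UniformSpace.Completion.coe_smul, ← UniformSpace.Completion.coe_star,
        ← UniformSpace.Completion.coe_star, ← UniformSpace.Completion.coe_smul, star_smul]

/-- The full group C*-algebra `C*(Γ)`. -/
abbrev FullGroupCStar (Γ : Type u) [Group Γ] : Type u :=
  CStarCompletion (fun _ : UnitaryRep Γ => True)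

/-- The ideal completion `C*_D(Γ)`. -/
abbrev IdealCStar {Γ : Type u} [Group Γ] (D : Ideal (lp (fun _ : Γ => ℂ) ∞)) : Type u :=
  CStarCompletion (UnitaryRep.IsDRep D)

/-- The canonical map from `Γ` to a completion of its group ring. -/
def CStarCompletion.of {Γ : Type u} [Group Γ] (P : UnitaryRep Γ → Prop) (s : Γ) :
    CStarCompletion P :=
  (GroupRing.of P s : UniformSpace.Completion (GroupRing P))

/-- `C*(Γ) = C*_D(Γ)`: the canonical map `C*(Γ) → C*_D(Γ)` is an isomorphism, i.e. there is an
isomorphism of C*-algebras that is the identity on `Γ` (hence on `ℂ[Γ]`). -/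
def FullEqIdealCStar {Γ : Type u} [Group Γ] (D : Ideal (lp (fun _ : Γ => ℂ) ∞)) : Prop :=
  ∃ Φ : FullGroupCStar Γ ≃⋆ₐ[ℂ] IdealCStar D,
    ∀ s : Γ, Φ (CStarCompletion.of _ s) = CStarCompletion.of _ s

/-! ### Amenability -/

/-- `h : Γ → ℂ` is positive definite: all matrices `[h(s_i s_j⁻¹)]` are positive semidefinite. -/
def IsPositiveDefinite {Γ : Type u} [Group Γ] (h : Γ → ℂ) : Prop :=
  ∀ (n : ℕ) (s : Fin n → Γ), (Matrix.of fun i j => h (s i * (s j)⁻¹)).PosSemidef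

/-- Amenability of a countable discrete group: there are finitely supported positive definite
functions converging pointwise to the constant function `1`. -/
def IsAmenableGroup (Γ : Type u) [Group Γ] [Countable Γ] : Prop :=
  ∃ h : ℕ → Γ → ℂ, (∀ n, IsPositiveDefinite (h n)) ∧ (∀ n, (Function.support (h n)).Finite) ∧
    ∀ s : Γ, Filter.Tendsto (fun n => h n s) Filter.atTop (nhds 1)

end

/-! The trivial representation gives `∑ s ∈ F, (1 + s)` full norm at least `2|F|`. If the `ℓ^p` norm
is the same, some `ℓ^p`-representation has a unit vector `ξ` in its dense subspace that almost
attains it, so each `ξ + π_s ξ` has norm almost 2. Hence `φ(s) = ⟨π_s ξ, ξ⟩` is positive definite,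
bounded by 1, in `ℓ^p` and close to 1 on `F`.

For a fixed `k ≥ p`, `φ^k` is positive definite (Schur product) and in `ℓ¹`. Convolution by an `ℓ¹`
positive definite `ψ` is a positive operator on `ℓ²(Γ)` commuting with right translations. With `S`
its square root, `η = S δ_1` has coefficient `ψ` in the right regular representation. Truncating `η`
makes the coefficients finitely supported. -/

open Filter Topology

/-! ### Positive definite functions -/

namespace IsPositiveDefinite

variable {Γ : Type u} [Group Γ]

theorem mul {f g : Γ → ℂ} (hf : IsPositiveDefinite f) (hg : IsPositiveDefinite g) :
    IsPositiveDefinite (f * g) := fun n s => (hf n s).hadamard (hg n s)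

theorem pow_succ {f : Γ → ℂ} (hf : IsPositiveDefinite f) (k : ℕ) :
    IsPositiveDefinite (f ^ (k + 1)) := by
  induction k with
  | zero => simpa using hf
  | succ k ih =>
    rw [_root_.pow_succ]
    exact ih.mul hf

theorem sum_nonneg {f : Γ → ℂ} (hf : IsPositiveDefinite f) (F : Finset Γ) (c : Γ → ℂ) :
    0 ≤ ∑ i ∈ F, ∑ j ∈ F, conj (c i) * (f (i * j⁻¹) * c j) := by
  have h := (hf F.card fun i => (F.equivFin.symm i : Γ)).dotProduct_mulVec_nonneg
    fun i => c (F.equivFin.symm i)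
  simp only [dotProduct, Matrix.mulVec, Finset.mul_sum, Matrix.of_apply, Pi.star_apply,
    RCLike.star_def] at h
  have key (g : Γ → ℂ) : ∑ i, g (F.equivFin.symm i : Γ) = ∑ i ∈ F, g i := by
    rw [Equiv.sum_comp F.equivFin.symm fun i : F => g i, Finset.sum_coe_sort F g]
  have h2 (i : Γ) : ∑ j, conj (c i) * (f (i * (F.equivFin.symm j : Γ)⁻¹) * c (F.equivFin.symm j))
      = ∑ j ∈ F, conj (c i) * (f (i * j⁻¹) * c j) :=
    key fun j => conj (c i) * (f (i * j⁻¹) * c j)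
  simp only [h2] at h
  rwa [key fun i => ∑ j ∈ F, conj (c i) * (f (i * j⁻¹) * c j)] at h

/-- The diagonal coefficients of a family of isometries which is multiplicative are positive
definite. -/
theorem inner_apply {H : Type*} [NormedAddCommGroup H] [InnerProductSpace ℂ H]
    (R : Γ → H →ₗᵢ[ℂ] H) (hone : ∀ v, R 1 v = v) (hmul : ∀ s t v, R (s * t) v = R s (R t v))
    (ξ : H) : IsPositiveDefinite fun s => inner ℂ ξ (R s ξ) := by
  intro n s
  -- Apply the isometry `R (s i)` to both arguments of a Gram entry.
  have h : (Matrix.of fun i j => inner ℂ ξ (R (s i * (s j)⁻¹) ξ)) =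
      Matrix.gram ℂ fun i => R (s i)⁻¹ ξ := by
    ext i j
    rw [Matrix.of_apply, Matrix.gram, Matrix.of_apply, hmul,
      ← (R (s i)).inner_map_map (R (s i)⁻¹ ξ), ← hmul (s i) (s i)⁻¹,
      mul_inv_cancel, hone]
  rw [h]
  exact Matrix.posSemidef_gram ℂ _

end IsPositiveDefinite

namespace lp

variable {ι : Type*}

/-- Composition with a permutation, as an isometry of `ℓ²`. -/
noncomputable def permute (σ : Equiv.Perm ι) :
    lp (fun _ : ι => ℂ) 2 →ₗᵢ[ℂ] lp (fun _ : ι => ℂ) 2 where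
  toFun f := ⟨fun t => f (σ t), memℓp_gen <|
    (σ.summable_iff (f := fun t => ‖f t‖ ^ (2 : ℝ≥0∞).toReal)).2 ((lp.memℓp f).summable (by simp))⟩
  map_add' f g := by ext; rfl
  map_smul' c f := by ext; rfl
  norm_map' f := by
    rw [lp.norm_eq_tsum_rpow (by simp), lp.norm_eq_tsum_rpow (by simp)]
    exact congrArg (· ^ _) (σ.tsum_eq fun t => ‖f t‖ ^ (2 : ℝ≥0∞).toReal)

@[simp]
theorem permute_apply (σ : Equiv.Perm ι) (f : lp (fun _ : ι => ℂ) 2) (t : ι) :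
    permute σ f t = f (σ t) := rfl

end lp

/-- As `‖f s‖ ≤ 1`, raising the exponent from `p` to `k` only decreases the terms. -/
theorem summable_norm_pow_of_memℓp {ι : Type*} {f : ι → ℂ} {p : ℝ≥0∞} (hp₀ : 0 < p.toReal)
    (hf : Memℓp f p) (hle : ∀ s, ‖f s‖ ≤ 1) {k : ℕ} (hk : p.toReal ≤ k) :
    Summable fun s => ‖(f ^ k) s‖ := by
  refine (hf.summable hp₀).of_nonneg_of_le (fun _ => norm_nonneg _) fun s => ?_
  rw [Pi.pow_apply, norm_pow, ← Real.rpow_natCast]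
  exact Real.rpow_le_rpow_of_exponent_ge' (norm_nonneg _) (hle s) hp₀.le hk

/-! ### Positive definite `ℓ¹` functions and the regular representation -/

section Regular

variable {Γ : Type u} [Group Γ]

/-- The operator of convolution with `ψ` on the left, on `ℓ²(Γ)`. -/
noncomputable def leftConvolution (ψ : Γ → ℂ) :
    lp (fun _ : Γ => ℂ) 2 →L[ℂ] lp (fun _ : Γ => ℂ) 2 :=
  ∑' s, ψ s • (lp.permute (Equiv.mulLeft s⁻¹)).toContinuousLinearMap

theorem hasSum_leftConvolution {ψ : Γ → ℂ} (hψ : Summable fun s => ‖ψ s‖) :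
    HasSum (fun s => ψ s • (lp.permute (Equiv.mulLeft s⁻¹)).toContinuousLinearMap)
      (leftConvolution ψ) := by
  refine (Summable.of_norm_bounded hψ fun s => ?_).hasSum
  rw [norm_smul]
  exact mul_le_of_le_one_right (norm_nonneg _) (LinearIsometry.norm_toContinuousLinearMap_le _)

theorem hasSum_leftConvolution_apply {ψ : Γ → ℂ} (hψ : Summable fun s => ‖ψ s‖)
    (f : lp (fun _ : Γ => ℂ) 2) :
    HasSum (fun s => ψ s • lp.permute (Equiv.mulLeft s⁻¹) f) (leftConvolution ψ f) :=
  (hasSum_leftConvolution hψ).mapL (ContinuousLinearMap.apply ℂ _ f)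

/-- Only `s = u * t⁻¹` translates `δ_t` to `δ_u`. These entries are exactly the matrices tested by
`IsPositiveDefinite`. -/
theorem inner_single_leftConvolution_single [DecidableEq Γ] {ψ : Γ → ℂ}
    (hψ : Summable fun s => ‖ψ s‖) (t u : Γ) (a b : ℂ) :
    inner ℂ (lp.single 2 u a) (leftConvolution ψ (lp.single 2 t b)) =
      conj a * (ψ (u * t⁻¹) * b) := by
  have h := (hasSum_leftConvolution_apply hψ (lp.single 2 t b)).mapL
    (innerSL ℂ (lp.single 2 u a : lp (fun _ : Γ => ℂ) 2))
  refine h.unique ?_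
  convert hasSum_single (u * t⁻¹) fun s hs => ?_ using 1
  · simp [lp.inner_single_left, mul_assoc, mul_comm, mul_left_comm]
  · have : s⁻¹ * u ≠ t := fun h => hs (by simp [← h])
    simp [lp.inner_single_left, Pi.single_eq_of_ne this]

theorem leftConvolution_nonneg {ψ : Γ → ℂ} (hpd : IsPositiveDefinite ψ)
    (hψ : Summable fun s => ‖ψ s‖) : 0 ≤ leftConvolution ψ := by
  classical
  rw [ContinuousLinearMap.nonneg_iff_isPositive, ContinuousLinearMap.isPositive_iff_complex]
  suffices h : ∀ f, 0 ≤ inner ℂ f (leftConvolution ψ f) by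
    intro f
    have hf : 0 ≤ inner ℂ (leftConvolution ψ f) f := by
      rw [← inner_conj_symm]
      exact star_nonneg_iff.2 (h f)
    obtain ⟨h1, h2⟩ := Complex.nonneg_iff.1 hf
    exact ⟨Complex.ext (by simp) (by simpa using h2), h1⟩
  intro f
  -- Nonnegativity is a closed condition, so finitely supported vectors suffice.
  have hcl : IsClosed {g : lp (fun _ : Γ => ℂ) 2 | 0 ≤ inner ℂ g (leftConvolution ψ g)} :=
    isClosed_le continuous_const (by fun_prop)
  refine hcl.mem_of_tendsto (lp.hasSum_single (by simp) f) (.of_forall fun F => ?_)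
  simp only [Set.mem_ofPred_eq, map_sum, sum_inner, inner_sum,
    inner_single_leftConvolution_single hψ]
  rw [Finset.sum_comm]
  exact hpd.sum_nonneg F f

theorem commute_leftConvolution_permute {ψ : Γ → ℂ} (hψ : Summable fun s => ‖ψ s‖) (s : Γ) :
    Commute (leftConvolution ψ) (lp.permute (Equiv.mulRight s)).toContinuousLinearMap := by
  refine ContinuousLinearMap.ext fun f => ?_
  refine (hasSum_leftConvolution_apply hψ _).unique ?_
  have h := (hasSum_leftConvolution_apply hψ f).mapL
    (lp.permute (Equiv.mulRight s)).toContinuousLinearMap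
  have heq (t : Γ) : ψ t • lp.permute (Equiv.mulLeft t⁻¹) (lp.permute (Equiv.mulRight s) f) =
      lp.permute (Equiv.mulRight s) (ψ t • lp.permute (Equiv.mulLeft t⁻¹) f) := by
    ext u
    simp [mul_assoc]
  exact (funext heq : (fun t => _) = _) ▸ h

/-- A positive operator has a self-adjoint square root that commutes with its commutant. -/
theorem ContinuousLinearMap.exists_isSelfAdjoint_mul_self_eq {H : Type*} [NormedAddCommGroup H]
    [InnerProductSpace ℂ H] [CompleteSpace H] {T : H →L[ℂ] H} (hT : 0 ≤ T) :
    ∃ S : H →L[ℂ] H, IsSelfAdjoint S ∧ S * S = T ∧ ∀ A, Commute T A → Commute S A :=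
  ⟨CFC.sqrt T, (CFC.sqrt_nonneg T).isSelfAdjoint, CFC.sqrt_mul_sqrt_self T hT,
    fun _ hA => hA.cfcₙ_nnreal _⟩

/-- A summable positive definite function is a diagonal coefficient of the right regular
representation. -/
theorem IsPositiveDefinite.exists_eq_inner_regular {ψ : Γ → ℂ} (hpd : IsPositiveDefinite ψ)
    (hψ : Summable fun s => ‖ψ s‖) :
    ∃ η : lp (fun _ : Γ => ℂ) 2, ∀ s, inner ℂ η (lp.permute (Equiv.mulRight s) η) = ψ s := by
  classical
  obtain ⟨S, hsa, hSS, hcomm⟩ := ContinuousLinearMap.exists_isSelfAdjoint_mul_self_eq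
    (leftConvolution_nonneg hpd hψ)
  -- With `T = S * S` the convolution operator: `⟨S δ_1, ρ_s S δ_1⟩ = ⟨S δ_1, S δ_{s⁻¹}⟩ = ⟨δ_1, T
  -- δ_{s⁻¹}⟩ = ψ(s)`.
  refine ⟨S (lp.single 2 1 1), fun s => ?_⟩
  have hc : lp.permute (Equiv.mulRight s) (S (lp.single 2 1 1)) =
      S (lp.permute (Equiv.mulRight s) (lp.single 2 1 1)) :=
    congrArg (fun A => A (lp.single 2 1 1)) (hcomm _ (commute_leftConvolution_permute hψ s)).eq.symm
  have hs : lp.permute (Equiv.mulRight s) (lp.single 2 1 (1 : ℂ)) = lp.single 2 s⁻¹ (1 : ℂ) := by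
    ext t
    simp [Pi.single_apply, mul_eq_one_iff_eq_inv]
  have hmove : inner ℂ (S (lp.single 2 1 1)) (S (lp.single 2 s⁻¹ 1)) =
      inner ℂ (lp.single 2 1 1 : lp (fun _ : Γ => ℂ) 2) (S (S (lp.single 2 s⁻¹ 1))) := by
    rw [← ContinuousLinearMap.adjoint_inner_right]
    rw [← ContinuousLinearMap.star_eq_adjoint, hsa.star_eq]
  rw [hc, hs, hmove, ← mul_apply_eq_comp, hSS,
    inner_single_leftConvolution_single hψ]
  simp

/-- A nonzero term needs `t` and `t * s` in the support of `ζ`, leaving finitely many `s`. -/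
theorem finite_support_inner_permute {ζ : lp (fun _ : Γ => ℂ) 2}
    (hζ : (Function.support ζ).Finite) :
    (Function.support fun s => inner ℂ ζ (lp.permute (Equiv.mulRight s) ζ)).Finite := by
  refine ((hζ.prod hζ).image fun q : Γ × Γ => q.1⁻¹ * q.2).subset fun s hs => ?_
  obtain ⟨t, ht⟩ : ∃ t, inner ℂ (ζ t) (ζ (t * s)) ≠ 0 := by
    by_contra! h0
    refine hs ?_
    simp only [lp.inner_eq_tsum, lp.permute_apply, Equiv.coe_mulRight, h0, tsum_zero]
  refine ⟨(t, t * s), ⟨fun h => ht ?_, fun h => ht ?_⟩, by simp⟩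
  · simp only at h
    rw [h, inner_zero_left]
  · simp only at h
    rw [h, inner_zero_right]

theorem IsPositiveDefinite.mem_closure_finite_support {ψ : Γ → ℂ} (hpd : IsPositiveDefinite ψ)
    (hψ : Summable fun s => ‖ψ s‖) :
    ψ ∈ closure {h : Γ → ℂ | IsPositiveDefinite h ∧ (Function.support h).Finite} := by
  classical
  obtain ⟨η, hη⟩ := hpd.exists_eq_inner_regular hψ
  have hlim := lp.hasSum_single (by simp) η
  refine mem_closure_of_tendsto (b := atTop)
    (f := fun (F : Finset Γ) s => inner ℂ (∑ i ∈ F, lp.single 2 i (η i))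
      (lp.permute (Equiv.mulRight s) (∑ i ∈ F, lp.single 2 i (η i)))) ?_ (.of_forall fun F => ?_)
  · refine tendsto_pi_nhds.2 fun s => ?_
    rw [← hη s]
    exact Tendsto.inner hlim (((lp.permute _).continuous.tendsto _).comp hlim)
  · refine ⟨.inner_apply (fun s => lp.permute (Equiv.mulRight s)) (fun v => ?_)
      (fun s t v => ?_) _, finite_support_inner_permute (F.finite_toSet.subset fun t ht => ?_)⟩
    · ext
      simp
    · ext
      simp [mul_assoc]
    · by_contra hF
      refine ht ?_
      rw [lp.coeFn_sum, Finset.sum_apply]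
      exact Finset.sum_eq_zero fun i hi =>
        lp.single_apply_ne _ _ _ fun h => hF (by simpa [h] using hi)

end Regular

/-! ### Almost invariant vectors in `D`-representations -/

section Representations

variable {Γ : Type u} [Group Γ]

/-- The trivial representation. -/
noncomputable def UnitaryRep.trivial (Γ : Type u) [Group Γ] : UnitaryRep Γ where
  H := EuclideanSpace ℂ PUnit.{u + 1}
  hom := 1

theorem UnitaryRep.isPositiveDefinite_matrixCoeff (π : UnitaryRep Γ) (ξ : π.H) :
    IsPositiveDefinite (π.matrixCoeff ξ ξ) :=
  .inner_apply (fun s => ⟨(π.op s : π.H →ₗ[ℂ] π.H), π.norm_op_apply s⟩)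
    (fun v => by simp [op]) (fun s t v => by simp [op]) ξ

namespace GroupRing

theorem card_le_norm_sum (F : Finset Γ) :
    2 * (F.card : ℝ) ≤ ‖∑ s ∈ F, (of (fun _ : UnitaryRep Γ => True) 1 + of _ s)‖ := by
  have h := norm_rep_le (∑ s ∈ F, (of (fun _ : UnitaryRep Γ => True) 1 + of _ s))
    (UnitaryRep.trivial Γ) trivial
  have hop (s : Γ) : (UnitaryRep.trivial Γ).op s = 1 := rfl
  have : Nontrivial (UnitaryRep.trivial Γ).H :=
    inferInstanceAs (Nontrivial (EuclideanSpace ℂ PUnit.{u + 1}))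
  refine le_of_eq_of_le ?_ h
  simp only [map_sum, map_add, rep_of, hop, Finset.sum_const, one_add_one_eq_two]
  rw [← Nat.cast_smul_eq_nsmul ℝ, norm_smul, ← one_add_one_eq_two (R := _ →L[ℂ] _),
    ← two_smul ℝ, norm_smul, norm_one]
  simp [mul_comm]

/-- The operator norm is determined on the dense subspace, where coefficients lie in `D`;
normalizing stays inside it. -/
theorem exists_unit_of_lt_norm {D : Ideal (lp (fun _ : Γ => ℂ) ∞)}
    {x : GroupRing (UnitaryRep.IsDRep D)} {c : ℝ} (hc : 0 ≤ c) (hx : c < ‖x‖) :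
    ∃ (π : UnitaryRep Γ) (ξ : π.H), ‖ξ‖ = 1 ∧ π.matrixCoeff ξ ξ ∈ D ∧ c < ‖rep π x ξ‖ := by
  contrapose! hx
  refine norm_le hc fun π ⟨H₀, hd, hH₀⟩ => ContinuousLinearMap.opNorm_le_bound _ hc fun v => ?_
  refine hd.induction (P := fun v => ‖rep π x v‖ ≤ c * ‖v‖) (fun ξ hξ => ?_)
    (isClosed_le (by fun_prop) (by fun_prop)) v
  rcases eq_or_ne ξ 0 with rfl | h0
  · simp
  · have hn : 0 < ‖ξ‖ := norm_pos_iff.2 h0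
    have hmem : ((‖ξ‖⁻¹ : ℝ) : ℂ) • ξ ∈ H₀ := H₀.smul_mem _ hξ
    have := hx π (((‖ξ‖⁻¹ : ℝ) : ℂ) • ξ)
      (by rw [norm_smul, Complex.norm_real, norm_inv, norm_norm, inv_mul_cancel₀ hn.ne'])
      (hH₀ _ hmem _ hmem)
    rw [map_smul, norm_smul, Complex.norm_real, norm_inv, norm_norm] at this
    rwa [mul_comm, ← inv_mul_le_iff₀ hn]

end GroupRing

/-- Isomorphisms of C*-algebras are isometric. -/
theorem FullEqIdealCStar.norm_sum_eq {D : Ideal (lp (fun _ : Γ => ℂ) ∞)} (h : FullEqIdealCStar D)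
    (F : Finset Γ) :
    ‖∑ s ∈ F, (GroupRing.of (UnitaryRep.IsDRep D) 1 + GroupRing.of _ s)‖ =
      ‖∑ s ∈ F, (GroupRing.of (fun _ : UnitaryRep Γ => True) 1 + GroupRing.of _ s)‖ := by
  obtain ⟨Φ, hΦ⟩ := h
  have coe_sum (P : UnitaryRep Γ → Prop) :
      ‖∑ s ∈ F, (GroupRing.of P 1 + GroupRing.of P s)‖ =
        ‖∑ s ∈ F, (CStarCompletion.of P 1 + CStarCompletion.of P s)‖ := by
    rw [← UniformSpace.Completion.norm_coe]
    congr 1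
    let ι := UniformSpace.Completion.coeRingHom (α := GroupRing P)
    exact (map_sum ι _ F).trans (Finset.sum_congr rfl fun s _ => map_add ι _ _)
  rw [coe_sum, coe_sum, ← StarAlgEquiv.norm_map Φ]
  simp [hΦ]

/-- For `z = ⟨v, w⟩`, `|z| ≤ 1` gives `|z - 1|² ≤ 2 - 2 Re z = 4 - ‖v + w‖²`, and this is at most `4
(2 - ‖v + w‖)`. -/
theorem norm_inner_sub_one_sq_le {H : Type*} [NormedAddCommGroup H] [InnerProductSpace ℂ H]
    {v w : H} (hv : ‖v‖ = 1) (hw : ‖w‖ = 1) {δ : ℝ} (h : 2 - δ ≤ ‖v + w‖) :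
    ‖inner ℂ v w - 1‖ ^ 2 ≤ 4 * δ := by
  have h1 := norm_add_sq (𝕜 := ℂ) v w
  have h2 : ‖inner ℂ v w‖ ≤ 1 := by simpa [hv, hw] using norm_inner_le_norm (𝕜 := ℂ) v w
  have h3 := norm_sub_sq_real (inner ℂ v w) (1 : ℂ)
  have h4 : inner ℝ (inner ℂ v w) (1 : ℂ) = (inner ℂ v w).re := by
    rw [Complex.inner, one_mul, Complex.conj_re]
  have h5 : ‖v + w‖ ≤ 2 := (norm_add_le v w).trans (by rw [hv, hw]; norm_num)
  have h6 : 0 ≤ ‖inner ℂ v w‖ := norm_nonneg _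
  rw [h3, h4, norm_one]
  rw [hv, hw, RCLike.re_to_complex] at h1
  have h7 : 0 ≤ ‖v + w‖ := norm_nonneg _
  nlinarith

/-- If finitely many vectors of norm at most `2` have an almost maximal sum, then each of them has
almost maximal norm. -/
theorem two_sub_le_norm_of_le_norm_sum {ι E : Type*} [NormedAddCommGroup E] {F : Finset ι}
    {v : ι → E} (hv : ∀ i ∈ F, ‖v i‖ ≤ 2) {δ : ℝ} (h : 2 * (F.card : ℝ) - δ ≤ ‖∑ i ∈ F, v i‖)
    {j : ι} (hj : j ∈ F) : 2 - δ ≤ ‖v j‖ := by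
  classical
  have h1 : ‖∑ i ∈ F.erase j, v i‖ ≤ (F.erase j).card * 2 :=
    (norm_sum_le_of_le _ fun i hi => hv i (Finset.mem_of_mem_erase hi)).trans_eq (by simp)
  rw [← Finset.add_sum_erase F v hj] at h
  have h2 := norm_add_le (v j) (∑ i ∈ F.erase j, v i)
  have h3 : ((F.erase j).card : ℝ) + 1 = F.card := by
    exact_mod_cast Finset.card_erase_add_one hj
  linarith

theorem FullEqIdealCStar.exists_isPositiveDefinite {D : Ideal (lp (fun _ : Γ => ℂ) ∞)}
    (h : FullEqIdealCStar D) (F : Finset Γ) {ε : ℝ} (hε : 0 < ε) :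
    ∃ φ ∈ D, IsPositiveDefinite φ ∧ (∀ s, ‖φ s‖ ≤ 1) ∧ ∀ s ∈ F, ‖φ s - 1‖ < ε := by
  rcases F.eq_empty_or_nonempty with rfl | hF
  · exact ⟨0, D.zero_mem, fun n s => by
      convert Matrix.PosSemidef.zero using 1
      ext; rfl, by simp, by simp⟩
  -- `δ ≤ 1` keeps the threshold `2|F| - δ` nonnegative for nonempty `F`.
  obtain ⟨δ, hδ, hδ1, hδε⟩ : ∃ δ : ℝ, 0 < δ ∧ δ ≤ 1 ∧ 4 * δ < ε ^ 2 :=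
    ⟨min 1 (ε ^ 2 / 8), by positivity, min_le_left _ _, by
      have := min_le_right 1 (ε ^ 2 / 8)
      nlinarith [pow_pos hε 2]⟩
  have hcard : (1 : ℝ) ≤ F.card := by exact_mod_cast hF.card_pos
  obtain ⟨π, ξ, hξ, hD, hlt⟩ := GroupRing.exists_unit_of_lt_norm
    (x := ∑ s ∈ F, (GroupRing.of (UnitaryRep.IsDRep D) 1 + GroupRing.of _ s))
    (c := 2 * F.card - δ) (by linarith) (by
      rw [h.norm_sum_eq]
      linarith [GroupRing.card_le_norm_sum F])
  have hop (s : Γ) : ‖π.op s ξ‖ = 1 := by rw [π.norm_op_apply, hξ]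
  have hone : π.op 1 ξ = ξ := by simp [UnitaryRep.op]
  refine ⟨π.matrixCoeff ξ ξ, hD, π.isPositiveDefinite_matrixCoeff ξ, fun s => ?_, fun s hs => ?_⟩
  · exact (norm_inner_le_norm _ _).trans_eq (by rw [hop, hξ, one_mul])
  · simp only [map_sum, map_add, GroupRing.rep_of, sum_apply,
      add_apply, hone] at hlt
    have h1 := two_sub_le_norm_of_le_norm_sum (v := fun s => ξ + π.op s ξ)
      (fun s _ => (norm_add_le _ _).trans (by rw [hop, hξ]; norm_num)) hlt.le hs
    exact lt_of_pow_lt_pow_left₀ 2 hε.le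
      ((norm_inner_sub_one_sq_le hξ (hop s) h1).trans_lt hδε)

theorem FullEqIdealCStar.one_mem_closure {D : Ideal (lp (fun _ : Γ => ℂ) ∞)}
    (h : FullEqIdealCStar D) :
    1 ∈ closure {f : Γ → ℂ | IsPositiveDefinite f ∧ (∀ s, ‖f s‖ ≤ 1) ∧ ∃ φ ∈ D, ⇑φ = f} := by
  classical
  choose φ hD hpd hle hφ using fun q : Finset Γ × ℕ =>
    h.exists_isPositiveDefinite q.1 (Nat.one_div_pos_of_nat (α := ℝ) (n := q.2))
  refine mem_closure_of_tendsto (b := atTop) (f := fun q => ⇑(φ q)) ?_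
    (.of_forall fun q => ⟨hpd q, hle q, φ q, hD q, rfl⟩)
  refine tendsto_pi_nhds.2 fun s => Metric.tendsto_atTop.2 fun ε hε => ?_
  obtain ⟨N, hN⟩ := exists_nat_one_div_lt hε
  refine ⟨({s}, N), fun q hq => ?_⟩
  rw [dist_eq_norm]
  exact (hφ q s (Finset.singleton_subset_iff.1 hq.1)).trans
    ((Nat.one_div_le_one_div hq.2).trans_lt hN)

end Representations

theorem mainTheorem11 {Γ : Type u} [Group Γ] [Countable Γ] (p : ℝ≥0∞) (hp₁ : 1 ≤ p) (hp : p ≠ ∞)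
    (h : FullEqIdealCStar (ellpIdeal Γ p)) : IsAmenableGroup Γ := by
  have hp₀ : 0 < p.toReal := ENNReal.toReal_pos (one_pos.trans_le hp₁).ne' hp
  have hmem : (1 : Γ → ℂ) ∈
      closure {h : Γ → ℂ | IsPositiveDefinite h ∧ (Function.support h).Finite} := by
    rw [← closure_closure]
    -- The exponent depends only on `p`, so this power map is pointwise continuous; it fixes 1.
    have h1 := map_mem_closure (f := fun f : Γ → ℂ => f ^ (⌈p.toReal⌉₊ + 1)) (by fun_prop)
      h.one_mem_closure (t := closure
        {h : Γ → ℂ | IsPositiveDefinite h ∧ (Function.support h).Finite}) ?_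
    · simpa using h1
    · rintro _ ⟨hpd, hle, φ, hφ, rfl⟩
      refine (hpd.pow_succ _).mem_closure_finite_support (summable_norm_pow_of_memℓp hp₀ hφ hle ?_)
      exact (Nat.le_ceil _).trans (by simp)
  -- Countability of `Γ` makes `Γ → ℂ` first countable, so sequences describe the closure.
  obtain ⟨f, hf, hlim⟩ := mem_closure_iff_seq_limit.1 hmem
  exact ⟨f, fun n => (hf n).1, fun n => (hf n).2, fun s => tendsto_pi_nhds.1 hlim s⟩
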